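/- **Conventions.** "Small" refers to a fixed universe, and all Hom-sets are small. A Grothendieck category is *locally noetherian* if it has a small set of generators that are noetherian objects (ascending chain condition on subobjects). A full subcategory $Z$ of $X$ is *closed* if it is closed under subobjects and quotient objects and the inclusion $i_*\colon Z\to X$ has a left adjoint $i^*$ and a right adjoint $i^!$. Let $o_X$ be the identity functor of $X$ and $o_Z=i_*i^!$ (sending $M$ to its largest subobject in $Z$), with the counit $\theta\colon o_Z\to o_X$. Let $K_Z\colon X\to X$ be the kernel of the unit $o_X\to i_*i^*$; so $K_Z(M)$ is the smallest subobject $N$ of $M$ with $M/N\in Z$. Let $\mathcal L(X,X)$ be the category of left exact functors $X\to X$ and natural transformations. For a small set $I$, $R^1\prod$ is the first right derived functor of the product functor $\prod_I X\to X$. For a collection $S$ of objects, an *$S$-projective effacement* of $M$ is an epimorphism $\pi\colon\underline M\to M$ such that for every epimorphism $f\colon P\to M$ with $\ker f\in S$ there is $g\colon\underline M\to P$ with $fg=\pi$; $X$ *has $S$-projective effacements* if every object of $X$ has one. **Theorem.** Let $X$ be a locally noetherian Grothendieck category, let $Z$ be a closed subcategory of $X$, and let $S$ be the collection of all objects of $Z$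 that are injective in the category $Z$. Then $\theta\colon o_Z\to o_X$ is a monomorphism in $\mathcal L(X,X)$ and has a cokernel $o_X\to G_Z$ in $\mathcal L(X,X)$, and the following are equivalent: 1. $G_Z$ has a left adjoint $F_Z$ (that is, $Z$ is *well-closed* in $X$). 2. $G_Z$ commutes with products of small families of objects of $X$. 3. $R^1\prod(N_\alpha)=0$ for every small family $\{N_\alpha\}$ of objects of $S$. 4. The natural map $\operatorname{Ext}^1(M,\prod_\alpha N_\alpha)\to\prod_\alpha\operatorname{Ext}^1(M,N_\alpha)$ is an isomorphism for every small family $\{N_\alpha\}$ of objects of $S$ and every $M\in X$. 5. $X$ has $S$-projective effacements. Moreover, suppose that these conditions hold, and let $F_Z$ be a left adjoint of $G_Z$. Then every $M\in X$ has an $S$-projective effacement whose kernel is in $S$. Fix any choice of $S$-projective effacements $\pi_M\colon\underline M\to M$ with $\ker\pi_M\in S$, one for each $M\in X$. Every morphism $f\colon M\to N$ has a lift $\underline f\colon\underline M\to\underline N$, i.e. $\pi_N\underline f=f\pi_M$, and there are isomorphisms $e_M\colon F_Z(M)\to K_Z(\underline M)$, $M\in X$, such that $e_N\circ F_Z(f)=K_Z(\underline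 f)\circ e_M$ for every $f\colon M\to N$ and every lift $\underline f$ of $f$. -/

import Mathlib

universe w u

open CategoryTheory CategoryTheory.Limits

namespace WellClosed

variable {X : Type u} [Category.{w} X]

/-- A category is locally noetherian if it has a small set of noetherian generators. -/
class IsLocallyNoetherianCategory (X : Type u) [Category.{w} X] : Prop where
  exists_noetherian_generators : ∃ (ι : Type w) (O : ι → X),
    (∀ i, IsNoetherianObject (O i)) ∧ (ObjectProperty.ofObj O).IsSeparating

/-- A full subcategory `Z` is closed if it is closed under subobjects and quotient objects and
the inclusion functor has both a left adjoint and a right adjoint. -/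
class IsClosedSubcategory (Z : ObjectProperty X) : Prop extends
    Z.IsClosedUnderSubobjects, Z.IsClosedUnderQuotients where
  isLeftAdjoint_ι : Z.ι.IsLeftAdjoint
  isRightAdjoint_ι : Z.ι.IsRightAdjoint

attribute [instance] IsClosedSubcategory.isLeftAdjoint_ι IsClosedSubcategory.isRightAdjoint_ι

/-- The collection `S` of the objects of `Z` that are injective in the category `Z`. -/
def injectivesIn (Z : ObjectProperty X) : ObjectProperty X :=
  fun M => ∃ hM : Z M, Injective (⟨M, hM⟩ : Z.FullSubcategory)

section Effacement

variable [Abelian X]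

/-- `π : P ⟶ M` is an `S`-projective effacement of `M`: it is an epimorphism that factors through
every epimorphism `f : Q ⟶ M` whose kernel is in `S`. -/
structure IsProjectiveEffacement (S : ObjectProperty X) {P M : X} (π : P ⟶ M) : Prop where
  epi : Epi π
  exists_lift : ∀ {Q : X} (f : Q ⟶ M) [Epi f], S (kernel f) → ∃ g : P ⟶ Q, g ≫ f = π

/-- The category `X` has `S`-projective effacements. -/
def HasProjectiveEffacements (S : ObjectProperty X) : Prop :=
  ∀ M : X, ∃ (P : X) (π : P ⟶ M), IsProjectiveEffacement S π

end Effacement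

noncomputable section Functors

variable (Z : ObjectProperty X) [IsClosedSubcategory Z]

/-- The functor `i_* i^! : X ⥤ X`, where `i^!` is the right adjoint of the inclusion `i_*`
of `Z` in `X`; it sends `M` to its largest subobject in `Z`. -/
abbrev largestSub : X ⥤ X := Functor.rightAdjoint Z.ι ⋙ Z.ι

instance : PreservesFiniteLimits (largestSub Z) := by
  have h₁ : PreservesLimitsOfSize.{0, 0} (Functor.rightAdjoint Z.ι) :=
    (Adjunction.ofIsLeftAdjoint Z.ι).rightAdjoint_preservesLimits
  have h₂ : PreservesLimitsOfSize.{0, 0} Z.ι :=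
    (Adjunction.ofIsRightAdjoint Z.ι).rightAdjoint_preservesLimits
  have h₃ : PreservesLimitsOfSize.{0, 0} (largestSub Z) := comp_preservesLimits _ _
  exact PreservesLimitsOfSize.preservesFiniteLimits _

/-- The object `o_Z` of the category of left exact functors `X ⥤ₗ X`. -/
abbrev oSub : X ⥤ₗ X := ⟨largestSub Z, inferInstanceAs (PreservesFiniteLimits (largestSub Z))⟩

/-- The object `o_X` of the category of left exact functors `X ⥤ₗ X`: the identity functor. -/
abbrev oId (X : Type u) [Category.{w} X] : X ⥤ₗ X :=
  ⟨𝟭 X, inferInstanceAs (PreservesFiniteLimits (𝟭 X))⟩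

/-- The natural morphism `o_Z ⟶ o_X` of left exact functors: the counit of the adjunction
between `i_*` and `i^!`. -/
abbrev θ : oSub Z ⟶ oId X := ObjectProperty.homMk (Adjunction.ofIsLeftAdjoint Z.ι).counit

/-- The functor `K_Z : X ⥤ X`, the kernel of the unit `𝟭 X ⟶ i_* i^*`, where `i^*` is the left
adjoint of the inclusion `i_*` of `Z` in `X`; it sends `M` to its smallest subobject `N` such
that `M / N` is in `Z`. -/
def K [Abelian X] : X ⥤ X := kernel (Adjunction.ofIsRightAdjoint Z.ι).unit

end Functors

noncomputable section Products

variable [Abelian X] [IsGrothendieckAbelian.{w} X]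

instance (ι : Type w) : EnoughInjectives (Discrete ι ⥤ X) where
  presentation F := ⟨
    { J := Discrete.functor fun i => Injective.under (F.obj ⟨i⟩)
      injective :=
        { factors := fun {A B} g f hf => by
            refine ⟨Discrete.natTrans fun i =>
              Injective.factorThru (J := Injective.under (F.obj ⟨i.as⟩)) (g.app i) (f.app i), ?_⟩
            ext i
            exact Injective.comp_factorThru (J := Injective.under (F.obj ⟨i.as⟩))
              (g.app i) (f.app i) }
      f := Discrete.natTrans fun i => Injective.ι (F.obj ⟨i.as⟩)
      mono := by
        have (i : Discrete ι) : Mono ((Discrete.natTrans (F := F)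
            (G := Discrete.functor fun i => Injective.under (F.obj ⟨i⟩))
            fun i => Injective.ι (F.obj ⟨i.as⟩)).app i) :=
          inferInstanceAs (Mono (Injective.ι (F.obj ⟨i.as⟩)))
        exact NatTrans.mono_of_mono_app _ }⟩

instance (ι : Type w) : (lim : (Discrete ι ⥤ X) ⥤ X).Additive where
  map_add {F G f g} := by
    apply limit.hom_ext
    intro j
    simp

/-- The first right derived functor `R¹∏` of the product functor from families of objects of `X`
indexed by `ι` (i.e. functors from the discrete category on `ι`) to `X`. -/
def R1Prod (ι : Type w) : (Discrete ι ⥤ X) ⥤ X :=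
  (lim : (Discrete ι ⥤ X) ⥤ X).rightDerived 1

/-- The natural map `Ext¹(M, ∏ N_α) → ∏ Ext¹(M, N_α)` induced by the projections. -/
def extProdMap (M : X) {ι : Type w} (N : ι → X) :
    Abelian.Ext M (∏ᶜ N) 1 →+ ∀ i, Abelian.Ext M (N i) 1 :=
  AddMonoidHom.pi fun i =>
    { toFun := fun e => e.comp (Abelian.Ext.mk₀ (Pi.π N i)) (add_zero 1)
      map_zero' := by simp
      map_add' := by simp }

end Products

end WellClosed

/-! Write `o_Z E` for the largest subobject of `E` in `Z`. The functor `M ↦ M / o_Z M` preserves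
monomorphisms, and the cokernel `G` of `θ` is its left exactification, with value at `M` the kernel
of `Q E ⟶ Q (E / M)` for `E` injective containing `M`. All later arguments use only four facts about
`μ : 𝟭 ⟶ G` (`IsQuotientUnit`), notably the exact sequence `0 ⟶ o_Z E ⟶ E ⟶ G E ⟶ 0` for injective
`E`. Here `o_Z E` is in `S`, and every object of `S` is a retract of such an object.

Condition 4 is the hub. For `0 ⟶ N i ⟶ E i ⟶ C i ⟶ 0` with `E i` injective, it says exactly that `∏
E ⟶ ∏ C` is epi (`extProdMap_bijective_iff`), which is also the vanishing of `R¹∏`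
(`isZero_R1Prod_iff`). If `G` commutes with products, this map for `C i = G (E i)` is `μ` at the
injective object `∏ E`, hence epi. Conversely, for an injective `E` containing a coseparator,
pulling back `∏ E ⟶ ∏ G E` along `M ⟶ ∏ G E`, indexed by all maps `M ⟶ G E`, gives an effacement
with kernel `∏ o_Z E` in `S` (`exists_effacement`). Any effacement annihilates the relevant `Ext¹`
classes, which gives 5 → 4.

An effacement `P ⟶ M` with kernel in `S` yields a universal arrow `M ⟶ G (K_Z P)`. Thus `G` has a
left adjoint, with value `K_Z P` at `M`. -/

namespace WellClosed

/-! ### Left exactification of an additive functor -/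

noncomputable section LeftExactification

lemma exists_extension {C : Type*} [Category* C] [EnoughInjectives C] {M N : C} (f : M ⟶ N) :
    ∃ v : Injective.under M ⟶ Injective.under N, Injective.ι M ≫ v = f ≫ Injective.ι N :=
  ⟨Injective.factorThru (f ≫ Injective.ι N) (Injective.ι M), Injective.comp_factorThru _ _⟩

variable {C : Type*} [Category* C] [Abelian C] {D : Type*} [Category* D] [Abelian D]
  (Q : C ⥤ D) [Q.Additive]

/-- Morphisms `v` and `v'` that agree on `M` have the same image under `Q` on the kernel of
`Q E ⟶ Q (E / M)`. -/
lemma comp_map_eq_of_comp_eq {M E N : C} (j : M ⟶ E) {v v' : E ⟶ N} (h : j ≫ v = j ≫ v')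
    {T : D} (t : T ⟶ Q.obj E) (ht : t ≫ Q.map (cokernel.π j) = 0) :
    t ≫ Q.map v = t ≫ Q.map v' := by
  have h₀ : j ≫ (v - v') = 0 := by simp [h]
  have h₁ : Q.map v - Q.map v' = Q.map (cokernel.π j) ≫ Q.map (cokernel.desc j _ h₀) := by
    rw [← Q.map_comp, cokernel.π_desc, Q.map_sub]
  rw [← sub_eq_zero, ← Preadditive.comp_sub, h₁, reassoc_of% ht, zero_comp]

variable [EnoughInjectives C]

/-- All extensions `v` of `f` have the same effect on the kernel. Quantifying over every `v` makes
functoriality and additivity independent of choices. -/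
lemma exists_map_kernel_ι {M N : C} (f : M ⟶ N) :
    ∃ g : kernel (Q.map (cokernel.π (Injective.ι M))) ⟶
        kernel (Q.map (cokernel.π (Injective.ι N))),
      ∀ v : Injective.under M ⟶ Injective.under N, Injective.ι M ≫ v = f ≫ Injective.ι N →
        g ≫ kernel.ι _ = kernel.ι _ ≫ Q.map v := by
  obtain ⟨v, hv⟩ := exists_extension f
  -- On `M`, the map `v` followed by the quotient map vanishes, so it can be replaced by `0`.
  have h₀ : (kernel.ι (Q.map (cokernel.π (Injective.ι M))) ≫ Q.map v) ≫
      Q.map (cokernel.π (Injective.ι N)) = 0 := by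
    rw [Category.assoc, ← Q.map_comp,
      comp_map_eq_of_comp_eq Q (Injective.ι M) (v' := 0) _ _ (kernel.condition _)]
    · simp
    · simp [reassoc_of% hv]
  refine ⟨kernel.lift _ _ h₀, fun v' hv' => ?_⟩
  rw [kernel.lift_ι]
  exact comp_map_eq_of_comp_eq Q _ (hv.trans hv'.symm) _ (kernel.condition _)

/-- The universal left exact functor under an additive functor `Q` that preserves
monomorphisms. -/
def leftExactification : C ⥤ D where
  obj M := kernel (Q.map (cokernel.π (Injective.ι M)))
  map f := (exists_map_kernel_ι Q f).choose
  map_id M := by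
    rw [← cancel_mono (kernel.ι _), (exists_map_kernel_ι Q (𝟙 M)).choose_spec (𝟙 _) (by simp)]
    simp
  map_comp {M N P} f g := by
    obtain ⟨v, hv⟩ := exists_extension f
    obtain ⟨v', hv'⟩ := exists_extension g
    rw [← cancel_mono (kernel.ι _),
      (exists_map_kernel_ι Q (f ≫ g)).choose_spec (v ≫ v') (by simp [reassoc_of% hv, hv']),
      Category.assoc, (exists_map_kernel_ι Q g).choose_spec v' hv', ← Category.assoc,
      (exists_map_kernel_ι Q f).choose_spec v hv]
    simp

/-- The inclusion of the value of `leftExactification Q` at `M` in the value of `Q` at an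
injective object containing `M`. -/
def leftExactι (M : C) : (leftExactification Q).obj M ⟶ Q.obj (Injective.under M) :=
  kernel.ι (Q.map (cokernel.π (Injective.ι M)))

instance (M : C) : Mono (leftExactι Q M) := inferInstanceAs (Mono (kernel.ι _))

lemma leftExactι_comp (M : C) : leftExactι Q M ≫ Q.map (cokernel.π (Injective.ι M)) = 0 :=
  kernel.condition _

lemma exists_comp_leftExactι {M : C} {T : D} (t : T ⟶ Q.obj (Injective.under M))
    (ht : t ≫ Q.map (cokernel.π (Injective.ι M)) = 0) :
    ∃ s : T ⟶ (leftExactification Q).obj M, s ≫ leftExactι Q M = t :=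
  ⟨kernel.lift _ t ht, kernel.lift_ι _ _ _⟩

lemma leftExactification_map_ι {M N : C} (f : M ⟶ N)
    (v : Injective.under M ⟶ Injective.under N) (hv : Injective.ι M ≫ v = f ≫ Injective.ι N) :
    (leftExactification Q).map f ≫ leftExactι Q N = leftExactι Q M ≫ Q.map v :=
  (exists_map_kernel_ι Q f).choose_spec v hv

instance : (leftExactification Q).Additive where
  map_add {M N f g} := by
    obtain ⟨v, hv⟩ := exists_extension f
    obtain ⟨v', hv'⟩ := exists_extension g
    refine (cancel_mono (leftExactι Q N)).1 ?_
    rw [leftExactification_map_ι Q (f + g) (v + v') (by simp [hv, hv']), Preadditive.add_comp,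
      leftExactification_map_ι Q f v hv, leftExactification_map_ι Q g v' hv']
    simp

/-- The embedding of `A` in its injective object extends along `A ⟶ B ⟶ under B` to `w`; then `v ≫
w` fixes `A`, so `Q (v ≫ w)` acts as the identity on the value at `A`. -/
instance leftExactification_map_mono {A B : C} (f : A ⟶ B) [Mono f] :
    Mono ((leftExactification Q).map f) := by
  refine Preadditive.mono_of_cancel_zero _ fun {T} x hx => ?_
  obtain ⟨v, hv⟩ := exists_extension f
  let w := Injective.factorThru (Injective.ι A) (f ≫ Injective.ι B)
  have hw : f ≫ Injective.ι B ≫ w = Injective.ι A := by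
    rw [← Category.assoc]
    exact Injective.comp_factorThru _ _
  have h₁ : leftExactι Q A ≫ Q.map (v ≫ w) = leftExactι Q A ≫ Q.map (𝟙 _) :=
    comp_map_eq_of_comp_eq Q (Injective.ι A) (by rw [reassoc_of% hv, hw, Category.comp_id]) _
      (leftExactι_comp Q A)
  refine (cancel_mono (leftExactι Q A)).1 ?_
  rw [Q.map_id, Category.comp_id] at h₁
  rw [← h₁, Q.map_comp, ← reassoc_of% leftExactification_map_ι Q f v hv, reassoc_of% hx]
  simp

variable [Q.PreservesMonomorphisms]

/-- The injective object containing `X₂` also contains `X₁`, and the defining kernel does not depend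
on which injective object is used. -/
lemma leftExactification_exists_lift {S : ShortComplex C} (hS : S.ShortExact) {T : D}
    (y : T ⟶ (leftExactification Q).obj S.X₂) (hy : y ≫ (leftExactification Q).map S.g = 0) :
    ∃ z : T ⟶ (leftExactification Q).obj S.X₁, z ≫ (leftExactification Q).map S.f = y := by
  have := hS.mono_f
  have := hS.epi_g
  let j := S.f ≫ Injective.ι S.X₂
  obtain ⟨y', hy'⟩ : ∃ y', y' = y ≫ leftExactι Q S.X₂ := ⟨_, rfl⟩
  -- Embed the quotient by `X₁` in an injective object by `k`; `Q k` is mono, so it suffices to test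
  -- after `k`. On `X₂` the resulting map agrees with one factoring through the injective object of
  -- `X₃`, where `y` dies.
  have hy'₀ : y' ≫ Q.map (cokernel.π j) = 0 := by
    let k := Injective.ι (cokernel j)
    let a : S.X₃ ⟶ Injective.under (cokernel j) :=
      hS.exact.desc (Injective.ι S.X₂ ≫ cokernel.π j ≫ k) (by
        rw [← Category.assoc, cokernel.condition_assoc, zero_comp])
    have ha : S.g ≫ a = Injective.ι S.X₂ ≫ cokernel.π j ≫ k := hS.exact.g_desc _ _
    let b := Injective.factorThru a (Injective.ι S.X₃)
    have hb : Injective.ι S.X₃ ≫ b = a := Injective.comp_factorThru _ _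
    obtain ⟨v, hv⟩ := exists_extension S.g
    have h₁ : leftExactι Q S.X₂ ≫ Q.map (cokernel.π j ≫ k) =
        leftExactι Q S.X₂ ≫ Q.map (v ≫ b) :=
      comp_map_eq_of_comp_eq Q (Injective.ι S.X₂) (by rw [reassoc_of% hv, hb, ha]) _
        (leftExactι_comp Q _)
    refine (cancel_mono (Q.map k)).1 ?_
    rw [hy', Category.assoc, Category.assoc, ← Q.map_comp, h₁, Q.map_comp,
      ← reassoc_of% leftExactification_map_ι Q S.g v hv, reassoc_of% hy, zero_comp, zero_comp]
  -- Comparison of the two injective objects containing `X₁`.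
  let w := Injective.factorThru (Injective.ι S.X₁) j
  have hw : j ≫ w = Injective.ι S.X₁ := Injective.comp_factorThru _ _
  obtain ⟨z, hz⟩ := exists_comp_leftExactι Q (M := S.X₁) (y' ≫ Q.map w) (by
    rw [Category.assoc, ← Q.map_comp, comp_map_eq_of_comp_eq Q j (v' := 0) _ _ hy'₀]
    · simp
    · rw [reassoc_of% hw, cokernel.condition, comp_zero])
  refine ⟨z, ?_⟩
  obtain ⟨v, hv⟩ := exists_extension S.f
  refine (cancel_mono (leftExactι Q S.X₂)).1 ?_
  rw [Category.assoc, leftExactification_map_ι Q S.f v hv, reassoc_of% hz, ← Q.map_comp,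
    comp_map_eq_of_comp_eq Q j (v' := 𝟙 _) _ _ hy'₀, Q.map_id, Category.comp_id, hy']
  rw [reassoc_of% hw, hv, Category.comp_id]

instance : PreservesFiniteLimits (leftExactification Q) := by
  refine ((Functor.preservesFiniteLimits_tfae (leftExactification Q)).out 0 3).1 fun S hS => ?_
  have := hS.mono_f
  have : Mono (S.map (leftExactification Q)).f := leftExactification_map_mono Q S.f
  refine ⟨?_, this⟩
  refine ShortComplex.exact_of_f_is_kernel _ ?_
  exact KernelFork.IsLimit.ofι' _ _ fun {T} y hy =>
    ⟨(leftExactification_exists_lift Q hS y hy).choose,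
      (leftExactification_exists_lift Q hS y hy).choose_spec⟩

omit [Q.PreservesMonomorphisms] in
lemma exists_unit_comp_leftExactι (M : C) :
    ∃ s : Q.obj M ⟶ (leftExactification Q).obj M, s ≫ leftExactι Q M = Q.map (Injective.ι M) :=
  exists_comp_leftExactι Q _ (by simp [← Q.map_comp])

/-- The natural morphism from `Q` to the universal left exact functor under `Q`. -/
def toLeftExactification : Q ⟶ leftExactification Q where
  app M := (exists_unit_comp_leftExactι Q M).choose
  naturality {M N} f := by
    obtain ⟨v, hv⟩ := exists_extension f
    rw [← cancel_mono (leftExactι Q N), Category.assoc, Category.assoc,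
      (exists_unit_comp_leftExactι Q N).choose_spec, leftExactification_map_ι Q f v hv,
      ← Category.assoc, (exists_unit_comp_leftExactι Q M).choose_spec, ← Q.map_comp,
      ← Q.map_comp, hv]

omit [Q.PreservesMonomorphisms] in
lemma toLeftExactification_app_ι (M : C) :
    (toLeftExactification Q).app M ≫ leftExactι Q M = Q.map (Injective.ι M) :=
  (exists_unit_comp_leftExactι Q M).choose_spec

instance (M : C) : Mono ((toLeftExactification Q).app M) :=
  mono_of_mono_fac (toLeftExactification_app_ι Q M)

/-- An injective `E` is a retract of `under E`, and the retraction `w` induces a section of the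
unit. -/
instance (E : C) [Injective E] : Epi ((toLeftExactification Q).app E) := by
  let w := Injective.factorThru (𝟙 E) (Injective.ι E)
  have hw : Injective.ι E ≫ w = 𝟙 E := Injective.comp_factorThru _ _
  have : (leftExactι Q E ≫ Q.map w) ≫ (toLeftExactification Q).app E = 𝟙 _ := by
    rw [← cancel_mono (leftExactι Q E), Category.assoc, Category.assoc,
      toLeftExactification_app_ι, ← Q.map_comp, comp_map_eq_of_comp_eq Q (Injective.ι E)
      (v' := 𝟙 _) (by simp [reassoc_of% hw]) _ (leftExactι_comp Q E)]
    simp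
  exact epi_of_epi_fac this

section Desc

variable {H : C ⥤ D} [PreservesFiniteLimits H]

omit [Q.PreservesMonomorphisms] in
-- Left exactness identifies `H M` with the kernel of `H E ⟶ H (E / M)`, so `ν` at `E` restricts to
-- the kernels.
lemma exists_desc_app (ν : Q ⟶ H) (M : C) :
    ∃ d : (leftExactification Q).obj M ⟶ H.obj M,
      d ≫ H.map (Injective.ι M) = leftExactι Q M ≫ ν.app _ := by
  have := Functor.additive_of_preserves_binary_products H
  let S := ShortComplex.mk (Injective.ι M) (cokernel.π (Injective.ι M)) (cokernel.condition _)
  have hS : S.Exact := ShortComplex.exact_cokernel _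
  have h₀ := (Functor.preservesFiniteLimits_tfae H).out 3 1
  have h := h₀.1 inferInstance S ⟨hS, inferInstanceAs (Mono (Injective.ι M))⟩
  have : Mono (S.map H).f := h.2
  exact ⟨h.1.lift (leftExactι Q M ≫ ν.app _) (by
      change (leftExactι Q M ≫ ν.app _) ≫ H.map (cokernel.π (Injective.ι M)) = 0
      rw [Category.assoc, ← ν.naturality, reassoc_of% leftExactι_comp Q M, zero_comp]),
    h.1.lift_f _ _⟩

omit [Q.PreservesMonomorphisms] in
lemma exists_desc (ν : Q ⟶ H) :
    ∃ d : leftExactification Q ⟶ H, toLeftExactification Q ≫ d = ν := by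
  have h (M : C) : Mono (H.map (Injective.ι M)) := inferInstance
  refine ⟨{ app := fun M => (exists_desc_app Q ν M).choose, naturality := fun M N f => ?_ }, ?_⟩
  · obtain ⟨v, hv⟩ := exists_extension f
    rw [← cancel_mono (H.map (Injective.ι N)), Category.assoc, Category.assoc,
      (exists_desc_app Q ν N).choose_spec, reassoc_of% leftExactification_map_ι Q f v hv,
      ν.naturality, ← H.map_comp, ← hv, H.map_comp, ← Category.assoc (Exists.choose _),
      (exists_desc_app Q ν M).choose_spec, Category.assoc]
  · ext M
    rw [← cancel_mono (H.map (Injective.ι M)), NatTrans.comp_app, Category.assoc,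
      (exists_desc_app Q ν M).choose_spec, reassoc_of% toLeftExactification_app_ι Q M,
      ν.naturality]

omit [Q.PreservesMonomorphisms] in
-- Since `H` preserves the embedding into an injective object, only values at injectives matter, and
-- there the unit is epi.
lemma leftExactification_hom_ext {d d' : leftExactification Q ⟶ H}
    (h : toLeftExactification Q ≫ d = toLeftExactification Q ≫ d') : d = d' := by
  ext M
  rw [← cancel_mono (H.map (Injective.ι M)), ← d.naturality, ← d'.naturality]
  congr 1
  rw [← cancel_epi ((toLeftExactification Q).app _)]
  exact NatTrans.congr_app h _

end Desc

end LeftExactification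

/-! ### The quotient by the largest subobject in `Z`, and the cokernel of `θ` -/

noncomputable section ClosedSubcategory

variable {X : Type u} [Category.{w} X] (Z : ObjectProperty X) [IsClosedSubcategory Z]

/-- The inclusion of the largest subobject that lies in `Z`. -/
abbrev largestSubι : largestSub Z ⟶ 𝟭 X := (Adjunction.ofIsLeftAdjoint Z.ι).counit

lemma prop_largestSub (M : X) : Z ((largestSub Z).obj M) :=
  ObjectProperty.FullSubcategory.property _

variable {Z}

lemma exists_comp_largestSubι {T M : X} (hT : Z T) (f : T ⟶ M) :
    ∃ g : T ⟶ (largestSub Z).obj M, g ≫ (largestSubι Z).app M = f := by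
  let adj := Adjunction.ofIsLeftAdjoint Z.ι
  let f' : Z.ι.obj ⟨T, hT⟩ ⟶ M := f
  refine ⟨Z.ι.map ((adj.homEquiv _ _) f'), ?_⟩
  have := adj.homEquiv_counit (X := ⟨T, hT⟩) (Y := M) (g := adj.homEquiv _ _ f')
  rw [Equiv.symm_apply_apply] at this
  exact this.symm

/-- The quotient map to the largest quotient that lies in `Z`. -/
abbrev largestQuotientπ (Z : ObjectProperty X) [IsClosedSubcategory Z] :
    𝟭 X ⟶ Functor.leftAdjoint Z.ι ⋙ Z.ι := (Adjunction.ofIsRightAdjoint Z.ι).unit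

lemma exists_largestQuotientπ_comp {T M : X} (hT : Z T) (f : M ⟶ T) :
    ∃ g : Z.ι.obj ((Functor.leftAdjoint Z.ι).obj M) ⟶ T, (largestQuotientπ Z).app M ≫ g = f := by
  let adj := Adjunction.ofIsRightAdjoint Z.ι
  let f' : M ⟶ Z.ι.obj ⟨T, hT⟩ := f
  refine ⟨Z.ι.map ((adj.homEquiv M _).symm f'), ?_⟩
  have := adj.homEquiv_unit (X := M) (Y := ⟨T, hT⟩) (f := (adj.homEquiv _ _).symm f')
  rw [Equiv.apply_symm_apply] at this
  exact this.symm

lemma largestSub_hom_ext {T M : X} (hT : Z T) {f g : T ⟶ (largestSub Z).obj M}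
    (h : f ≫ (largestSubι Z).app M = g ≫ (largestSubι Z).app M) : f = g := by
  let adj := Adjunction.ofIsLeftAdjoint Z.ι
  let f' : (⟨T, hT⟩ : Z.FullSubcategory) ⟶ (Functor.rightAdjoint Z.ι).obj M :=
    ObjectProperty.homMk f
  let g' : (⟨T, hT⟩ : Z.FullSubcategory) ⟶ (Functor.rightAdjoint Z.ι).obj M :=
    ObjectProperty.homMk g
  have : f' = g' := by
    apply (adj.homEquiv _ _).symm.injective
    rw [adj.homEquiv_counit, adj.homEquiv_counit]
    exact h
  exact congrArg (fun k => Z.ι.map k) this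

variable [Abelian X]

instance (M : X) : Mono ((largestSubι Z).app M) := by
  refine Preadditive.mono_of_kernel_zero (largestSub_hom_ext ?_ ?_)
  · exact Z.prop_of_mono (kernel.ι ((largestSubι Z).app M)) (prop_largestSub Z M)
  · rw [kernel.condition, zero_comp]

variable (Z)

/-- The functor `M ↦ M / o_Z M`. -/
def quotientSub : X ⥤ X := cokernel (largestSubι Z)

/-- The quotient map `M ⟶ M / o_Z M`. -/
def quotientSubπ : 𝟭 X ⟶ quotientSub Z := cokernel.π (largestSubι Z)

lemma largestSubι_comp_quotientSubπ : largestSubι Z ≫ quotientSubπ Z = 0 :=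
  cokernel.condition _

instance (M : X) : Epi ((quotientSubπ Z).app M) := by
  have : Epi (quotientSubπ Z) := inferInstanceAs (Epi (cokernel.π (largestSubι Z)))
  infer_instance

lemma exists_lift_of_comp_quotientSubπ {T M : X} (b : T ⟶ M)
    (hb : b ≫ (quotientSubπ Z).app M = 0) :
    ∃ g : T ⟶ (largestSub Z).obj M, g ≫ (largestSubι Z).app M = b := by
  let S := ShortComplex.mk (largestSubι Z) (quotientSubπ Z) (largestSubι_comp_quotientSubπ Z)
  have hS : S.Exact := ShortComplex.exact_cokernel _
  have h := hS.map ((evaluation X X).obj M)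
  have : Mono (S.map ((evaluation X X).obj M)).f :=
    inferInstanceAs (Mono ((largestSubι Z).app M))
  exact ⟨h.lift b hb, h.lift_f _ _⟩

instance : (quotientSub Z).Additive where
  map_add {M N f g} := by
    have h (k : M ⟶ N) : (quotientSubπ Z).app M ≫ (quotientSub Z).map k =
      k ≫ (quotientSubπ Z).app N := ((quotientSubπ Z).naturality k).symm
    rw [← cancel_epi ((quotientSubπ Z).app M), Preadditive.comp_add, h, h, h,
      Preadditive.add_comp]

/-- The intersection of `A` with `o_Z B` lies in `Z`, being a subobject of `o_Z B`, and is therefore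
contained in `o_Z A`. -/
instance : (quotientSub Z).PreservesMonomorphisms where
  preserves {A B} f _ := by
    have h := (quotientSubπ Z).naturality f
    refine (Preadditive.mono_iff_cancel_zero _).2 fun T x hx => ?_
    obtain ⟨T', p, _, a, ha⟩ :=
      surjective_up_to_refinements_of_epi ((quotientSubπ Z).app A) x
    obtain ⟨b, hb⟩ := exists_lift_of_comp_quotientSubπ Z (a ≫ f) (by
      have h' : f ≫ (quotientSubπ Z).app B = (quotientSubπ Z).app A ≫ (quotientSub Z).map f := h
      rw [Category.assoc, h', ← Category.assoc]
      change (a ≫ (quotientSubπ Z).app A) ≫ _ = 0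
      rw [← ha, Category.assoc, hx, comp_zero])
    have hR : Z (pullback f ((largestSubι Z).app B)) :=
      Z.prop_of_mono (pullback.snd f ((largestSubι Z).app B)) (prop_largestSub Z B)
    obtain ⟨c, hc⟩ := exists_comp_largestSubι hR (pullback.fst f ((largestSubι Z).app B))
    have ha' : a = pullback.lift a b hb.symm ≫ c ≫ (largestSubι Z).app A := by
      rw [hc, pullback.lift_fst]
    have h₀ : (largestSubι Z).app A ≫ (quotientSubπ Z).app A = 0 :=
      NatTrans.congr_app (largestSubι_comp_quotientSubπ Z) A
    rw [← cancel_epi p, comp_zero, ha, ha']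
    simp only [Category.assoc]
    rw [h₀, comp_zero, comp_zero]

variable [EnoughInjectives X]

/-- The cokernel of `θ Z` in the category of left exact functors. -/
def cokernelθ : X ⥤ₗ X :=
  ⟨leftExactification (quotientSub Z),
    inferInstanceAs (PreservesFiniteLimits (leftExactification (quotientSub Z)))⟩

/-- The projection from `oId X` to the cokernel of `θ Z`. -/
def cokernelθπ : oId X ⟶ cokernelθ Z :=
  ObjectProperty.homMk (quotientSubπ Z ≫ toLeftExactification (quotientSub Z))

lemma θ_comp_cokernelθπ : θ Z ≫ cokernelθπ Z = 0 := by
  apply (LeftExactFunctor.forget X X).map_injective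
  change largestSubι Z ≫ quotientSubπ Z ≫ toLeftExactification (quotientSub Z) = 0
  rw [reassoc_of% largestSubι_comp_quotientSubπ Z, zero_comp]

/-- The left exactification of `M ↦ M / o_Z M` is the cokernel of `θ Z`. -/
def isColimitCokernelθ : IsColimit (CokernelCofork.ofπ (cokernelθπ Z) (θ_comp_cokernelθπ Z)) :=
  have : Epi (quotientSubπ Z) := inferInstanceAs (Epi (cokernel.π (largestSubι Z)))
  have hd {H : X ⥤ₗ X} (ν : oId X ⟶ H) (hν : θ Z ≫ ν = 0) :
      ∃ d : cokernelθ Z ⟶ H, cokernelθπ Z ≫ d = ν := by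
    have : PreservesFiniteLimits H.obj := H.property
    have hν' : largestSubι Z ≫ ν.hom = 0 := congrArg (fun k => k.hom) hν
    obtain ⟨d, hd⟩ := exists_desc (quotientSub Z) (H := H.obj) (cokernel.desc _ ν.hom hν')
    refine ⟨ObjectProperty.homMk d, ?_⟩
    apply (LeftExactFunctor.forget X X).map_injective
    change (quotientSubπ Z ≫ toLeftExactification (quotientSub Z)) ≫ d = ν.hom
    rw [Category.assoc, hd]
    exact cokernel.π_desc _ _ _
  CokernelCofork.IsColimit.ofπ _ _ (fun ν hν => (hd ν hν).choose)
    (fun ν hν => (hd ν hν).choose_spec) fun {H} ν hν d hd' => by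
      have : PreservesFiniteLimits H.obj := H.property
      apply (LeftExactFunctor.forget X X).map_injective
      refine leftExactification_hom_ext (quotientSub Z) (H := H.obj) ?_
      rw [← cancel_epi (quotientSubπ Z)]
      have := congrArg (fun k => k.hom) (hd'.trans (hd ν hν).choose_spec.symm)
      exact (Category.assoc _ _ _).symm.trans (this.trans (Category.assoc _ _ _))

lemma hasCokernel_θ : HasCokernel (θ Z) := ⟨⟨⟨_, isColimitCokernelθ Z⟩⟩⟩

omit [EnoughInjectives X] in
lemma mono_θ : Mono (θ Z) := by
  have : Mono ((LeftExactFunctor.forget X X).map (θ Z)) := by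
    exact NatTrans.mono_of_mono_app (largestSubι Z)
  exact (LeftExactFunctor.forget X X).mono_of_mono_map this

variable {Z}

/-- The properties of a cokernel of `θ Z` that are needed: the functor `G` is left exact, the
kernel of `μ` is the largest subobject in `Z`, and `μ` is an epimorphism on injective objects. -/
structure IsQuotientUnit (Z : ObjectProperty X) [IsClosedSubcategory Z] {G : X ⥤ X}
    (μ : 𝟭 X ⟶ G) : Prop where
  preservesFiniteLimits : PreservesFiniteLimits G
  zero (M : X) : (largestSubι Z).app M ≫ μ.app M = 0
  exists_lift {T M : X} (b : T ⟶ M) (hb : b ≫ μ.app M = 0) :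
    ∃ g : T ⟶ (largestSub Z).obj M, g ≫ (largestSubι Z).app M = b
  epi (E : X) [Injective E] : Epi (μ.app E)

lemma isQuotientUnit_cokernelθπ : IsQuotientUnit Z (cokernelθπ Z).hom where
  preservesFiniteLimits := (cokernelθ Z).property
  zero M := NatTrans.congr_app (congrArg (fun k => k.hom) (θ_comp_cokernelθπ Z)) M
  exists_lift {T M} b hb := by
    refine exists_lift_of_comp_quotientSubπ Z b ?_
    rw [← cancel_mono ((toLeftExactification (quotientSub Z)).app M), zero_comp, Category.assoc]
    exact hb
  epi E _ := inferInstanceAs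
    (Epi ((quotientSubπ Z).app E ≫ (toLeftExactification (quotientSub Z)).app E))

lemma IsQuotientUnit.of_isColimit {G : X ⥤ₗ X} {μ : oId X ⟶ G} {hμ : θ Z ≫ μ = 0}
    (h : IsColimit (CokernelCofork.ofπ μ hμ)) : IsQuotientUnit Z μ.hom := by
  let e : cokernelθ Z ≅ G := (isColimitCokernelθ Z).coconePointUniqueUpToIso h
  have he : cokernelθπ Z ≫ e.hom = μ :=
    (isColimitCokernelθ Z).comp_coconePointUniqueUpToIso_hom h .one
  have he' (M : X) : (cokernelθπ Z).hom.app M ≫ e.hom.hom.app M = μ.hom.app M :=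
    NatTrans.congr_app (congrArg (fun k => k.hom) he) M
  have : IsIso e.hom.hom := inferInstanceAs (IsIso ((LeftExactFunctor.forget X X).map e.hom))
  have h₀ := isQuotientUnit_cokernelθπ (Z := Z)
  exact
    { preservesFiniteLimits := G.property
      zero := fun M => NatTrans.congr_app (congrArg (fun k => k.hom) hμ) M
      exists_lift := fun {T M} b hb => by
        refine h₀.exists_lift b ?_
        rw [← cancel_mono (e.hom.hom.app M), Category.assoc, zero_comp]
        exact (congrArg (b ≫ ·) (he' M)).trans hb
      epi := fun E _ => by
        have := h₀.epi E
        rw [← he']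
        infer_instance }

end ClosedSubcategory

/-! ### Injectives of `Z`, effacements and the functor `K_Z` -/

noncomputable section Effacements

variable {X : Type u} [Category.{w} X] {Z : ObjectProperty X} [IsClosedSubcategory Z]

/-- Closure under subobjects allows injectivity in `Z` to be tested by monomorphisms of `X` with
target in `Z`. -/
lemma injectivesIn_iff {N : X} : injectivesIn Z N ↔ Z N ∧ ∀ {A B : X} (f : A ⟶ B) [Mono f],
    Z B → ∀ g : A ⟶ N, ∃ h : B ⟶ N, f ≫ h = g := by
  refine ⟨fun ⟨hN, h⟩ => ⟨hN, fun {A B} f _ hB g => ?_⟩,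
    fun ⟨hN, h⟩ => ⟨hN, ⟨fun {A B} g f _ => ?_⟩⟩⟩
  · have hA : Z A := Z.prop_of_mono f hB
    let f' : (⟨A, hA⟩ : Z.FullSubcategory) ⟶ ⟨B, hB⟩ := ObjectProperty.homMk f
    let g' : (⟨A, hA⟩ : Z.FullSubcategory) ⟶ ⟨N, hN⟩ := ObjectProperty.homMk g
    have : Mono (Z.ι.map f') := inferInstanceAs (Mono f)
    have : Mono f' := Z.ι.mono_of_mono_map this
    exact ⟨(Injective.factorThru g' f').hom,
      congrArg (fun k => k.hom) (Injective.comp_factorThru g' f')⟩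
  · have : Z.ι.PreservesMonomorphisms :=
      Functor.preservesMonomorphisms_of_adjunction (Adjunction.ofIsRightAdjoint Z.ι)
    have : Mono f.hom := inferInstanceAs (Mono (Z.ι.map f))
    obtain ⟨k, hk⟩ := h f.hom B.property g.hom
    exact ⟨ObjectProperty.homMk k, ObjectProperty.hom_ext _ hk⟩

lemma injectivesIn_of_retract {N N' : X} (hN : injectivesIn Z N) (i : N' ⟶ N) (r : N ⟶ N')
    (hr : i ≫ r = 𝟙 N') : injectivesIn Z N' := by
  have : Mono i := mono_of_mono_fac hr
  rw [injectivesIn_iff] at hN ⊢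
  refine ⟨Z.prop_of_mono i hN.1, fun f _ hB g => ?_⟩
  obtain ⟨h, hh⟩ := hN.2 f hB (g ≫ i)
  exact ⟨h ≫ r, by rw [reassoc_of% hh, hr, Category.comp_id]⟩

instance : (injectivesIn Z).IsClosedUnderIsomorphisms where
  of_iso e h := injectivesIn_of_retract h e.inv e.hom e.inv_hom_id

lemma exists_retraction {N Y : X} (hN : injectivesIn Z N) (j : N ⟶ Y) [Mono j] (hY : Z Y) :
    ∃ r : Y ⟶ N, j ≫ r = 𝟙 N :=
  (injectivesIn_iff.1 hN).2 j hY (𝟙 N)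

lemma injectivesIn_largestSub (E : X) [Injective E] : injectivesIn Z ((largestSub Z).obj E) := by
  rw [injectivesIn_iff]
  refine ⟨prop_largestSub Z E, fun {A B} f _ hB g => ?_⟩
  obtain ⟨h, hh⟩ := exists_comp_largestSubι (M := E) hB
    (Injective.factorThru (g ≫ (largestSubι Z).app E) f)
  refine ⟨h, largestSub_hom_ext (Z.prop_of_mono f hB) ?_⟩
  rw [Category.assoc, hh, Injective.comp_factorThru]

/-- The projections factor through the largest quotient in `Z`, so the map to that quotient is a
split mono. -/
lemma prop_pi {ι : Type*} (N : ι → X) [HasProduct N] (hN : ∀ i, Z (N i)) : Z (∏ᶜ N) := by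
  choose g hg using fun i => exists_largestQuotientπ_comp (hN i) (Pi.π N i)
  have : (largestQuotientπ Z).app (∏ᶜ N) ≫ Pi.lift g = 𝟙 _ :=
    Pi.hom_ext _ _ fun i => by simpa using hg i
  have : Mono ((largestQuotientπ Z).app (∏ᶜ N)) := mono_of_mono_fac this
  exact Z.prop_of_mono ((largestQuotientπ Z).app (∏ᶜ N)) (ObjectProperty.FullSubcategory.property _)

lemma injectivesIn_pi {ι : Type*} (N : ι → X) [HasProduct N] (hN : ∀ i, injectivesIn Z (N i)) :
    injectivesIn Z (∏ᶜ N) := by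
  rw [injectivesIn_iff]
  refine ⟨prop_pi N fun i => (injectivesIn_iff.1 (hN i)).1, fun f _ hB g => ?_⟩
  choose h hh using fun i => (injectivesIn_iff.1 (hN i)).2 f hB (g ≫ Pi.π N i)
  exact ⟨Pi.lift h, Pi.hom_ext _ _ fun i => by simp [hh i]⟩

variable [Abelian X]

/-- The pullback of `f` along `h` is an epimorphism onto `M` with the same kernel as `f`. -/
lemma IsProjectiveEffacement.exists_comp_eq {S : ObjectProperty X} [S.IsClosedUnderIsomorphisms]
    {P M : X} {π : P ⟶ M} (hπ : IsProjectiveEffacement S π) {A B : X} (f : A ⟶ B) [Epi f]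
    (hf : S (kernel f)) (h : M ⟶ B) : ∃ t : P ⟶ A, t ≫ f = π ≫ h := by
  have sq := (IsPullback.of_hasPullback f h).flip
  have := isIso_kernel_map_of_isPullback sq
  obtain ⟨g, hg⟩ := hπ.exists_lift (pullback.snd f h)
    (S.prop_of_iso (asIso (kernel.map _ _ _ _ sq.w)).symm hf)
  exact ⟨g ≫ pullback.fst f h, by rw [Category.assoc, pullback.condition, reassoc_of% hg]⟩

/-- The inclusion `K_Z ⟶ 𝟭`. -/
def Kι (Z : ObjectProperty X) [IsClosedSubcategory Z] : K Z ⟶ 𝟭 X :=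
  kernel.ι (Adjunction.ofIsRightAdjoint Z.ι).unit

lemma Kι_app_comp_largestQuotientπ (P : X) :
    (Kι Z).app P ≫ (largestQuotientπ Z).app P = 0 :=
  NatTrans.congr_app (kernel.condition (Adjunction.ofIsRightAdjoint Z.ι).unit) P

instance (P : X) : Mono ((Kι Z).app P) := by
  have : Mono (Kι Z) := inferInstanceAs (Mono (kernel.ι _))
  infer_instance

lemma Kι_app_comp {P Y : X} (t : P ⟶ Y) (hY : Z Y) : (Kι Z).app P ≫ t = 0 := by
  obtain ⟨g, rfl⟩ := exists_largestQuotientπ_comp hY t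
  rw [← Category.assoc]
  rw [Kι_app_comp_largestQuotientπ, zero_comp]

lemma exact_Kι (P : X) : (ShortComplex.mk ((Kι Z).app P) ((largestQuotientπ Z).app P)
    (Kι_app_comp_largestQuotientπ P)).Exact :=
  (ShortComplex.exact_kernel (Adjunction.ofIsRightAdjoint Z.ι).unit).map ((evaluation X X).obj P)

/-! ### The universal arrow `M ⟶ G (K_Z P)` -/

variable {G : X ⥤ X} {μ : 𝟭 X ⟶ G}

namespace IsQuotientUnit

variable (h : IsQuotientUnit Z μ)

include h

lemma app_eq_zero {Y : X} (hY : Z Y) : μ.app Y = 0 := by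
  obtain ⟨g, hg⟩ := exists_comp_largestSubι hY (𝟙 Y)
  have := congrArg (· ≫ μ.app Y) hg
  simpa [h.zero] using this.symm

lemma injectivesIn_kernel_app (E : X) [Injective E] : injectivesIn Z (kernel (μ.app E)) := by
  obtain ⟨g, hg⟩ := h.exists_lift (M := E) (kernel.ι (μ.app E)) (kernel.condition _)
  refine injectivesIn_of_retract (injectivesIn_largestSub (Z := Z) E) g
    (kernel.lift _ _ (h.zero E)) ?_
  rw [← cancel_mono (kernel.ι _), Category.assoc, kernel.lift_ι, hg, Category.id_comp]

/-- The functor `G` sends the exact sequence defining `K_Z P` to an exact sequence. -/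
lemma exists_lift_map_Kι {T P : X} (a : T ⟶ G.obj P)
    (ha : a ≫ G.map ((largestQuotientπ Z).app P) = 0) :
    ∃ c : T ⟶ G.obj ((K Z).obj P), c ≫ G.map ((Kι Z).app P) = a := by
  have := h.preservesFiniteLimits
  have := Functor.additive_of_preserves_binary_products G
  have h₀ := (Functor.preservesFiniteLimits_tfae G).out 3 1
  have h₁ := h₀.1 inferInstance _ ⟨exact_Kι (Z := Z) P, inferInstanceAs (Mono ((Kι Z).app P))⟩
  have := h₁.2
  have : Mono ((ShortComplex.mk ((Kι Z).app P) ((largestQuotientπ Z).app P)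
    (Kι_app_comp_largestQuotientπ P)).map G).f := h₁.2
  exact ⟨h₁.1.lift a ha, h₁.1.lift_f _ _⟩

/-- For an epimorphism `π : P ⟶ M` with kernel in `Z` there is a canonical morphism from `M` to
`G (K_Z P)`. -/
lemma exists_hom_K {P M : X} (π : P ⟶ M) [Epi π] (hπ : Z (kernel π)) :
    ∃ c : M ⟶ G.obj ((K Z).obj P), π ≫ c ≫ G.map ((Kι Z).app P) = μ.app P := by
  -- `μ` vanishes on objects of `Z`, so `μ.app P` descends along `π` to `M`.
  have h₀ : kernel.ι π ≫ μ.app P = 0 := by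
    have := μ.naturality (kernel.ι π)
    rw [h.app_eq_zero hπ, zero_comp] at this
    exact this
  have : Epi (ShortComplex.mk (kernel.ι π) π (kernel.condition π)).g := inferInstanceAs (Epi π)
  let a : M ⟶ G.obj P := (ShortComplex.exact_kernel π).desc (μ.app P) h₀
  have ha : π ≫ a = μ.app P := (ShortComplex.exact_kernel π).g_desc _ _
  -- The descended map dies in `G` of the largest quotient of `P` in `Z`, again because `μ` vanishes
  -- there.
  obtain ⟨c, hc⟩ := h.exists_lift_map_Kι a (by
    rw [← cancel_epi π, comp_zero, reassoc_of% ha]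
    have := μ.naturality ((largestQuotientπ Z).app P)
    have h₁ : μ.app ((Functor.leftAdjoint Z.ι ⋙ Z.ι).obj P) = 0 :=
      h.app_eq_zero (ObjectProperty.FullSubcategory.property _)
    rw [h₁, comp_zero] at this
    exact this.symm)
  exact ⟨c, by rw [hc, ha]⟩

section

variable {P M : X} {π : P ⟶ M} (hπ : IsProjectiveEffacement (injectivesIn Z) π)
  {c : M ⟶ G.obj ((K Z).obj P)} (hc : π ≫ c ≫ G.map ((Kι Z).app P) = μ.app P)

include hπ hc

omit h hπ in
lemma comp_map_eq {Y : X} (t : P ⟶ Y) :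
    π ≫ c ≫ G.map ((Kι Z).app P ≫ t) = t ≫ μ.app Y := by
  have := μ.naturality t
  rw [← hc] at this
  simpa using this.symm

/-- The kernel of `E ⟶ G E` is in `S`, so the effacement lifts `π ≫ m` to a map `P ⟶ E`, which is
then restricted to `K_Z P`. -/
lemma exists_map_eq_of_injective {E : X} [Injective E] (m : M ⟶ G.obj E) :
    ∃ s : (K Z).obj P ⟶ E, c ≫ G.map s = m := by
  have := h.epi E
  have := hπ.epi
  obtain ⟨t, ht⟩ := hπ.exists_comp_eq (μ.app E) (h.injectivesIn_kernel_app E) m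
  refine ⟨(Kι Z).app P ≫ t, ?_⟩
  rw [← cancel_epi π, comp_map_eq hc]
  exact ht

omit hπ in
-- Extend `s` to `t : P ⟶ E`. The hypothesis forces `t` to land in `o_Z E`, and `K_Z P` is killed by
-- every map to an object of `Z`.
lemma eq_zero_of_injective {E : X} [Injective E] (s : (K Z).obj P ⟶ E)
    (hs : c ≫ G.map s = 0) : s = 0 := by
  obtain ⟨t, ht⟩ : ∃ t : P ⟶ E, (Kι Z).app P ≫ t = s :=
    ⟨Injective.factorThru s ((Kι Z).app P), Injective.comp_factorThru _ _⟩
  have h₀ := comp_map_eq hc t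
  rw [ht, hs, comp_zero] at h₀
  obtain ⟨g, rfl⟩ := h.exists_lift t h₀.symm
  rw [← ht, ← Category.assoc, Kι_app_comp g (prop_largestSub Z E), zero_comp]

variable [EnoughInjectives X]

omit hπ in
lemma eq_of_comp_map_eq {Y : X} {s s' : (K Z).obj P ⟶ Y} (hs : c ≫ G.map s = c ≫ G.map s') :
    s = s' := by
  have := h.preservesFiniteLimits
  have := Functor.additive_of_preserves_binary_products G
  rw [← cancel_mono (Injective.ι Y), ← sub_eq_zero]
  refine h.eq_zero_of_injective hc _ ?_
  rw [G.map_sub, G.map_comp, G.map_comp, Preadditive.comp_sub, reassoc_of% hs, sub_self]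

/-- Embed `Y` in an injective object; the map found there lands in `Y` because uniqueness makes its
image in the quotient zero. -/
lemma exists_comp_map_eq {Y : X} (m : M ⟶ G.obj Y) :
    ∃ s : (K Z).obj P ⟶ Y, c ≫ G.map s = m := by
  have := h.preservesFiniteLimits
  have := Functor.additive_of_preserves_binary_products G
  obtain ⟨s, hs⟩ := h.exists_map_eq_of_injective hπ hc (m ≫ G.map (Injective.ι Y))
  have h₀ : s ≫ cokernel.π (Injective.ι Y) = 0 := by
    refine h.eq_of_comp_map_eq hc ?_
    rw [G.map_comp, reassoc_of% hs, ← G.map_comp, cokernel.condition]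
    simp
  have h₁ := ShortComplex.exact_cokernel (Injective.ι Y)
  have : Mono (ShortComplex.mk _ _ (cokernel.condition (Injective.ι Y))).f :=
    inferInstanceAs (Mono (Injective.ι Y))
  refine ⟨h₁.lift s h₀, ?_⟩
  have h₂ : h₁.lift s h₀ ≫ Injective.ι Y = s := h₁.lift_f _ _
  rw [← cancel_mono (G.map (Injective.ι Y)), Category.assoc, ← G.map_comp, h₂, hs]

/-- The morphism `c : M ⟶ G (K_Z P)` is universal. -/
lemma hasInitial_structuredArrow : HasInitial (StructuredArrow M G) := by
  have (A : StructuredArrow M G) : Nonempty (StructuredArrow.mk c ⟶ A) := by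
    obtain ⟨s, hs⟩ := h.exists_comp_map_eq hπ hc A.hom
    exact ⟨StructuredArrow.homMk s hs⟩
  have (A : StructuredArrow M G) : Subsingleton (StructuredArrow.mk c ⟶ A) :=
    ⟨fun f g => StructuredArrow.hom_ext _ _ (h.eq_of_comp_map_eq hc
      ((StructuredArrow.w f).trans (StructuredArrow.w g).symm))⟩
  exact hasInitial_of_unique (StructuredArrow.mk c)

lemma isIso_homEquiv_symm {F : X ⥤ X} (adj : F ⊣ G) : IsIso ((adj.homEquiv M _).symm c) := by
  obtain ⟨s, hs⟩ := h.exists_comp_map_eq hπ hc (adj.unit.app M)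
  refine ⟨s, ?_, ?_⟩
  · apply (adj.homEquiv _ _).injective
    rw [adj.homEquiv_naturality_right, Equiv.apply_symm_apply, hs, adj.homEquiv_id]
  · refine h.eq_of_comp_map_eq hc ?_
    rw [G.map_comp, reassoc_of% hs, G.map_id, Category.comp_id, ← adj.homEquiv_unit,
      Equiv.apply_symm_apply]

end

variable [EnoughInjectives X]

lemma isRightAdjoint (hS : ∀ M : X, ∃ (P : X) (π : P ⟶ M),
    IsProjectiveEffacement (injectivesIn Z) π ∧ injectivesIn Z (kernel π)) :
    G.IsRightAdjoint := by
  have (M : X) : HasInitial (StructuredArrow M G) := by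
    obtain ⟨P, π, hπ, hk⟩ := hS M
    have := hπ.epi
    obtain ⟨c, hc⟩ := h.exists_hom_K π (injectivesIn_iff.1 hk).1
    exact h.hasInitial_structuredArrow hπ hc
  exact isRightAdjointOfStructuredArrowInitials G

/-- `e M` is adjoint to the universal arrow `c M`. Naturality holds for every lift `g`, since
`comp_map_eq` applies to an arbitrary morphism out of `P M`. -/
lemma exists_iso_K {F : X ⥤ X} (adj : F ⊣ G) (P : X → X) (π : ∀ M, P M ⟶ M)
    (hπ : ∀ M, IsProjectiveEffacement (injectivesIn Z) (π M) ∧ injectivesIn Z (kernel (π M))) :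
    (∀ {M N : X} (f : M ⟶ N), ∃ g : P M ⟶ P N, g ≫ π N = π M ≫ f) ∧
      ∃ e : ∀ M, F.obj M ≅ (K Z).obj (P M),
        ∀ {M N : X} (f : M ⟶ N) (g : P M ⟶ P N), g ≫ π N = π M ≫ f →
          F.map f ≫ (e N).hom = (e M).hom ≫ (K Z).map g := by
  have hepi (M : X) : Epi (π M) := (hπ M).1.epi
  refine ⟨fun {M N} f => (hπ M).1.exists_comp_eq (π N) (hπ N).2 f, ?_⟩
  choose c hc using fun M => h.exists_hom_K (π M) (injectivesIn_iff.1 (hπ M).2).1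
  have (M : X) := h.isIso_homEquiv_symm (hπ M).1 (hc M) adj
  refine ⟨fun M => asIso ((adj.homEquiv M _).symm (c M)), fun {M N} f g hg => ?_⟩
  rw [asIso_hom, asIso_hom, ← adj.homEquiv_naturality_left_symm,
    ← adj.homEquiv_naturality_right_symm]
  congr 1
  have := h.preservesFiniteLimits
  rw [← cancel_mono (G.map ((Kι Z).app (P N))), ← cancel_epi (π M), Category.assoc,
    ← reassoc_of% hg, hc, Category.assoc, ← G.map_comp, (Kι Z).naturality g, Functor.id_map,
    comp_map_eq (hc M) g]

end IsQuotientUnit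

end Effacements

/-! ### `Ext¹` and products -/

noncomputable section ExtOne

variable {X : Type u} [Category.{w} X] [Abelian X]

section HomToExt

open Abelian

variable [HasExt.{w} X] {S : ShortComplex X} (hS : S.ShortExact) {M : X}

/-- The connecting homomorphism `Hom(M, S.X₃) → Ext¹(M, S.X₁)`. -/
def homToExt (h : M ⟶ S.X₃) : Ext M S.X₁ 1 := (Ext.mk₀ h).comp hS.extClass (zero_add 1)

lemma homToExt_add (h h' : M ⟶ S.X₃) :
    homToExt hS (h + h') = homToExt hS h + homToExt hS h' := by
  simp [homToExt, Ext.mk₀_add]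

lemma exists_homToExt_eq [Injective S.X₂] (x : Ext M S.X₁ 1) : ∃ h, homToExt hS h = x := by
  obtain ⟨x₃, hx₃⟩ := Ext.covariant_sequence_exact₁ M hS x (Ext.eq_zero_of_injective _)
    (zero_add 1)
  exact ⟨Ext.homEquiv₀ x₃, by rw [homToExt, Ext.mk₀_homEquiv₀_apply, hx₃]⟩

lemma homToExt_eq_zero_iff (h : M ⟶ S.X₃) : homToExt hS h = 0 ↔ ∃ t, t ≫ S.g = h := by
  refine ⟨fun h₀ => ?_, ?_⟩
  · obtain ⟨x, hx⟩ := Ext.covariant_sequence_exact₃ M hS (Ext.mk₀ h) (zero_add 1) h₀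
    refine ⟨Ext.homEquiv₀ x, (Ext.mk₀_bijective _ _).1 ?_⟩
    rw [← Ext.mk₀_comp_mk₀, Ext.mk₀_homEquiv₀_apply, hx]
  · rintro ⟨t, rfl⟩
    rw [homToExt,
    ← Ext.mk₀_comp_mk₀, Ext.comp_assoc_of_second_deg_zero]
    simp

lemma mk₀_comp_homToExt {P : X} (π : P ⟶ M) (h : M ⟶ S.X₃) :
    (Ext.mk₀ π).comp (homToExt hS h) (zero_add 1) = homToExt hS (π ≫ h) :=
  Ext.mk₀_comp_mk₀_assoc _ _ _

lemma homToExt_comp_mk₀ {S' : ShortComplex X} (hS' : S'.ShortExact) (φ : S ⟶ S')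
    (h : M ⟶ S.X₃) :
    (homToExt hS h).comp (Ext.mk₀ φ.τ₁) (add_zero 1) = homToExt hS' (h ≫ φ.τ₃) := by
  rw [homToExt, Ext.comp_assoc_of_third_deg_zero,
    ShortComplex.ShortExact.extClass_naturality hS hS', homToExt,
    ← Ext.mk₀_comp_mk₀, Ext.comp_assoc_of_second_deg_zero]

end HomToExt

section Pi

variable {ι : Type*} [HasProductsOfShape ι X] (S : ι → ShortComplex X)

/-- The product of a family of short complexes. -/
abbrev piComplex : ShortComplex X where
  X₁ := ∏ᶜ fun i => (S i).X₁
  X₂ := ∏ᶜ fun i => (S i).X₂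
  X₃ := ∏ᶜ fun i => (S i).X₃
  f := Limits.Pi.map fun i => (S i).f
  g := Limits.Pi.map fun i => (S i).g
  zero := Pi.hom_ext _ _ fun i => by simp

/-- The projections of the product of a family of short complexes. -/
abbrev piComplexπ (i : ι) : piComplex S ⟶ S i where
  τ₁ := Pi.π _ i
  τ₂ := Pi.π _ i
  τ₃ := Pi.π _ i

variable {S} (hS : ∀ i, (S i).ShortExact)

include hS

lemma mono_piComplex_f : Mono (piComplex S).f := by
  have (i : ι) : Mono (S i).f := (hS i).mono_f
  exact inferInstanceAs (Mono (Limits.Pi.map fun i => (S i).f))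

lemma piComplex_exact : (piComplex S).Exact := by
  have := mono_piComplex_f hS
  have (i : ι) : Mono (S i).f := (hS i).mono_f
  refine ShortComplex.exact_of_f_is_kernel _ (KernelFork.IsLimit.ofι' _ _ fun {T} k hk => ?_)
  have hk' (i : ι) : (k ≫ Pi.π _ i) ≫ (S i).g = 0 := by
    have := congrArg (· ≫ Pi.π _ i) hk
    simpa using this
  refine ⟨Pi.lift fun i => (hS i).exact.lift (k ≫ Pi.π _ i) (hk' i), Pi.hom_ext _ _ fun i => ?_⟩
  simp [(hS i).exact.lift_f]

end Pi

section ExtProd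

variable [IsGrothendieckAbelian.{w} X] {ι : Type w}

lemma extProdMap_apply {M : X} (N : ι → X) (x : Abelian.Ext M (∏ᶜ N) 1) (i : ι) :
    extProdMap M N x i = x.comp (Abelian.Ext.mk₀ (Pi.π N i)) (add_zero 1) := rfl

section

variable {S : ι → ShortComplex X} (hS : ∀ i, (S i).ShortExact)

/-- The short exact complex `∏ S.X₁ ⟶ ∏ S.X₂ ⟶ coker`. -/
abbrev piCokernelComplex (S : ι → ShortComplex X) : ShortComplex X :=
  ShortComplex.mk (Limits.Pi.map fun i => (S i).f) (cokernel.π (Limits.Pi.map fun i => (S i).f))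
    (cokernel.condition _)

/-- The canonical morphism from `piCokernelComplex S` to the product of the complexes `S`. -/
abbrev piCokernelComplexHom (S : ι → ShortComplex X) : piCokernelComplex S ⟶ piComplex S where
  τ₁ := 𝟙 _
  τ₂ := 𝟙 _
  τ₃ := cokernel.desc _ (piComplex S).g (piComplex S).zero
  comm₁₂ := by simp
  comm₂₃ := by simp

include hS

lemma piCokernelComplex_shortExact : (piCokernelComplex S).ShortExact where
  exact := ShortComplex.exact_cokernel _
  mono_f := mono_piComplex_f hS
  epi_g := inferInstanceAs (Epi (cokernel.π (Limits.Pi.map fun i => (S i).f)))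

lemma mono_piCokernelComplexHom_τ₃ : Mono (piCokernelComplexHom S).τ₃ :=
  (piComplex_exact hS).mono_cokernelDesc

lemma homToExt_comp_π {M : X} (h : M ⟶ cokernel (Limits.Pi.map fun i => (S i).f)) (i : ι) :
    extProdMap M (fun i => (S i).X₁) (homToExt (piCokernelComplex_shortExact hS) h) i =
      homToExt (hS i) (h ≫ (piCokernelComplexHom S).τ₃ ≫ Pi.π _ i) := by
  have := homToExt_comp_mk₀ (piCokernelComplex_shortExact hS) (hS i)
    (piCokernelComplexHom S ≫ piComplexπ S i) h
  rw [ShortComplex.comp_τ₁, ShortComplex.comp_τ₃] at this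
  rw [extProdMap_apply, ← this]
  congr 2
  exact (Category.id_comp _).symm

end

/-- A class is given by a map `h : M ⟶ (∏ E) / (∏ N)`. If its components vanish, the components of
`h` lift to the `E i`; the lifts assemble to a lift of `h` because `(∏ E) / (∏ N) ⟶ ∏ C` is mono. -/
lemma extProdMap_injective (M : X) (N : ι → X) : Function.Injective (extProdMap M N) := by
  rw [injective_iff_map_eq_zero]
  intro x hx
  let S (i : ι) : ShortComplex X :=
    ShortComplex.mk (Injective.ι (N i)) (cokernel.π (Injective.ι (N i))) (cokernel.condition _)
  have hS (i : ι) : (S i).ShortExact :=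
    { exact := ShortComplex.exact_cokernel _
      mono_f := inferInstanceAs (Mono (Injective.ι (N i)))
      epi_g := inferInstanceAs (Epi (cokernel.π (Injective.ι (N i)))) }
  have : Injective (piCokernelComplex S).X₂ :=
    inferInstanceAs (Injective (∏ᶜ fun i => Injective.under (N i)))
  obtain ⟨h, rfl⟩ := exists_homToExt_eq (piCokernelComplex_shortExact hS) x
  have h₀ (i : ι) : homToExt (hS i) (h ≫ (piCokernelComplexHom S).τ₃ ≫ Pi.π _ i) = 0 := by
    rw [← homToExt_comp_π hS h i]
    exact congrFun hx i
  simp only [homToExt_eq_zero_iff] at h₀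
  choose t ht using h₀
  refine (homToExt_eq_zero_iff _ _).2 ⟨Pi.lift t, ?_⟩
  have := mono_piCokernelComplexHom_τ₃ hS
  rw [← cancel_mono (piCokernelComplexHom S).τ₃]
  refine Pi.hom_ext _ _ fun i => ?_
  simpa using ht i

/-- For short exact sequences `0 ⟶ N i ⟶ E i ⟶ C i ⟶ 0` with `E i` injective, the natural maps
`Ext¹(M, ∏ N) → ∏ Ext¹(M, N i)` are surjective if and only if `∏ E ⟶ ∏ C` is an epimorphism. -/
lemma extProdMap_bijective_iff {S : ι → ShortComplex X} (hS : ∀ i, (S i).ShortExact)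
    (hE : ∀ i, Injective (S i).X₂) :
    (∀ M : X, Function.Bijective (extProdMap M fun i => (S i).X₁)) ↔ Epi (piComplex S).g := by
  have hT := piCokernelComplex_shortExact hS
  refine ⟨fun h => ?_, fun h M => ⟨extProdMap_injective M _, fun e => ?_⟩⟩
  -- Take `M = ∏ C` and the classes of the projections. A common preimage is represented by `k`,
  -- whose components differ from the projections by maps that lift to the `E i`.
  · obtain ⟨x, hx⟩ := (h (piComplex S).X₃).2 fun i => homToExt (hS i) (Pi.π _ i)
    have : Injective (piCokernelComplex S).X₂ :=
      inferInstanceAs (Injective (∏ᶜ fun i => (S i).X₂))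
    obtain ⟨k, rfl⟩ := exists_homToExt_eq hT x
    have h₀ (i : ι) :
        ∃ t, t ≫ (S i).g = k ≫ (piCokernelComplexHom S).τ₃ ≫ Pi.π _ i - Pi.π _ i := by
      rw [← homToExt_eq_zero_iff (hS i)]
      have h₁ := homToExt_add (hS i) (k ≫ (piCokernelComplexHom S).τ₃ ≫ Pi.π _ i - Pi.π _ i)
        (Pi.π _ i)
      rw [sub_add_cancel, ← homToExt_comp_π hS k i, hx] at h₁
      simpa using h₁
    choose t ht using h₀
    -- Correcting `k` by these lifts gives a section of `(∏ E) / (∏ N) ⟶ ∏ C`.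
    have h₂ : (k - Pi.lift t ≫ (piCokernelComplex S).g) ≫ (piCokernelComplexHom S).τ₃ = 𝟙 _ := by
      refine Pi.hom_ext _ _ fun i => ?_
      simp [Preadditive.sub_comp, ht]
    have : Epi (piCokernelComplexHom S).τ₃ := epi_of_epi_fac h₂
    have h₃ : (piComplex S).g = (piCokernelComplex S).g ≫ (piCokernelComplexHom S).τ₃ := by simp
    have : Epi (piCokernelComplex S).g := hT.epi_g
    rw [h₃]
    exact epi_comp _ _
  · have hP : (piComplex S).ShortExact := 
      { exact := piComplex_exact hS
        mono_f := mono_piComplex_f hS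
        epi_g := h }
    choose k hk using fun i => exists_homToExt_eq (hS i) (e i)
    refine ⟨homToExt hP (Pi.lift k), funext fun i => ?_⟩
    have := homToExt_comp_mk₀ hP (hS i) (piComplexπ S i) (Pi.lift k)
    rw [extProdMap_apply]
    refine this.trans ?_
    rw [← hk]
    simp

end ExtProd

end ExtOne

/-! ### The first derived functor of the product -/

noncomputable section DerivedProduct

/-- For a left exact functor `F` and `a : A ⟶ B` with `a ≫ b = 0`, the complex
`F A ⟶ F B ⟶ F C` is exact if and only if `F A ⟶ F (ker b)` is an epimorphism. -/
lemma exact_map_iff_epi_map_kernel_lift {C D : Type*} [Category* C] [Abelian C] [Category* D]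
    [Abelian D] (F : C ⥤ D) [F.Additive] [PreservesFiniteLimits F] (S : ShortComplex C) :
    (S.map F).Exact ↔ Epi (F.map (kernel.lift S.g S.f S.zero)) := by
  have h₀ : F.map S.f ≫ F.map S.g = 0 := (S.map F).zero
  have h : F.map (kernel.lift S.g S.f S.zero) ≫ (PreservesKernel.iso F S.g).hom =
      kernel.lift (F.map S.g) (F.map S.f) h₀ := by
    rw [← cancel_mono (kernel.ι _), Category.assoc, kernel.lift_ι]
    simp [← F.map_comp]
  rw [ShortComplex.exact_iff_epi_kernel_lift]
  change Epi (kernel.lift (F.map S.g) (F.map S.f) h₀) ↔ _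
  rw [← h]
  exact epi_comp_iff_of_isIso _ (PreservesKernel.iso F S.g).hom

lemma epi_lim_map_iff {X : Type*} [Category* X] {ι : Type*} [HasLimitsOfShape (Discrete ι) X]
    {F G : Discrete ι ⥤ X} (α : F ⟶ G) :
    Epi ((lim : (Discrete ι ⥤ X) ⥤ X).map α) ↔ Epi (Limits.Pi.map fun i => α.app ⟨i⟩) := by
  have h : (Pi.isoLimit F).hom ≫ lim.map α =
      (Limits.Pi.map fun i => α.app ⟨i⟩) ≫ (Pi.isoLimit G).hom :=
    limit.hom_ext fun ⟨i⟩ => by simp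
  rw [← epi_comp_iff_of_epi (Pi.isoLimit F).hom, h]
  exact epi_comp_iff_of_isIso _ (Pi.isoLimit G).hom

variable {X : Type u} [Category.{w} X] [Abelian X] [IsGrothendieckAbelian.{w} X] {ι : Type w}

/-- An injective family is a retract of a family of injective objects. -/
lemma injective_obj {J : Discrete ι ⥤ X} [Injective J] (i : Discrete ι) : Injective (J.obj i) := by
  let α : J ⟶ Discrete.functor fun i => Injective.under (J.obj ⟨i⟩) :=
    Discrete.natTrans fun i => Injective.ι (J.obj ⟨i.as⟩)
  have (i : Discrete ι) : Mono (α.app i) := inferInstanceAs (Mono (Injective.ι (J.obj ⟨i.as⟩)))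
  have : Mono α := NatTrans.mono_of_mono_app _
  have h : α ≫ Injective.factorThru (𝟙 J) α = 𝟙 J := Injective.comp_factorThru _ _
  have : Injective ((Discrete.functor fun i => Injective.under (J.obj ⟨i⟩)).obj i) :=
    inferInstanceAs (Injective (Injective.under (J.obj ⟨i.as⟩)))
  refine ⟨fun {A B} g f _ => ⟨Injective.factorThru (g ≫ α.app i) f ≫
    (Injective.factorThru (𝟙 J) α).app i, ?_⟩⟩
  have h' : α.app i ≫ (Injective.factorThru (𝟙 J) α).app i = 𝟙 _ := NatTrans.congr_app h i
  rw [Injective.comp_factorThru_assoc, Category.assoc, h', Category.comp_id]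

/-- For an injective resolution `I` of the family, vanishing of the first cohomology of `∏ I` means
that `∏ I⁰ ⟶ ∏ ker(I¹ ⟶ I²)` is epi. This is the criterion of `extProdMap_bijective_iff` for `0 ⟶ N
⟶ I⁰ ⟶ ker(I¹ ⟶ I²) ⟶ 0`. -/
lemma isZero_R1Prod_iff (N : ι → X) : IsZero ((R1Prod ι).obj (Discrete.functor N)) ↔
    ∀ M : X, Function.Bijective (extProdMap M N) := by
  let I := injectiveResolution (Discrete.functor N)
  let F : (Discrete ι ⥤ X) ⥤ X := lim
  let S₀ : ShortComplex (Discrete ι ⥤ X) :=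
    ShortComplex.mk _ _ (I.cocomplex.d_comp_d 0 1 2)
  have hS₀ : S₀.Exact := I.exact_succ 0
  let j : Discrete.functor N ⟶ I.cocomplex.X 0 := I.ι.f 0
  have hj : j ≫ S₀.f = 0 := I.ι_f_zero_comp_complex_d
  have hker : IsLimit (KernelFork.ofι j hj) := I.isLimitKernelFork
  let S : ShortComplex (Discrete ι ⥤ X) :=
    ShortComplex.mk j (kernel.lift S₀.g S₀.f S₀.zero) (by
      rw [← cancel_mono (kernel.ι _), Category.assoc, kernel.lift_ι, hj, zero_comp])
  have hS : S.ShortExact :=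
    { exact := by
        refine ShortComplex.exact_of_f_is_kernel _ ?_
        exact isKernelOfComp (kernel.ι S₀.g) S₀.f hker S.zero
          (kernel.lift_ι _ _ S₀.zero)
      mono_f := inferInstanceAs (Mono (I.ι.f 0))
      epi_g := (ShortComplex.exact_iff_epi_kernel_lift S₀).1 hS₀ }
  have h₁ := extProdMap_bijective_iff (S := fun i => S.map ((evaluation (Discrete ι) X).obj ⟨i⟩))
    (fun i => hS.map_of_exact _) (fun i => injective_obj (J := I.cocomplex.X 0) ⟨i⟩)
  refine Iff.trans ?_ h₁.symm
  refine Iff.trans ?_ (epi_lim_map_iff S.g)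
  refine Iff.trans ?_ (exact_map_iff_epi_map_kernel_lift F S₀)
  refine (Iso.isZero_iff (I.isoRightDerivedObj F 1)).trans ?_
  refine (HomologicalComplex.exactAt_iff_isZero_homology _ _).symm.trans ?_
  exact HomologicalComplex.exactAt_iff' _ 0 1 2 (by simp) (by simp)

end DerivedProduct

/-! ### The implications between the conditions -/

noncomputable section Equivalences

variable {X : Type u} [Category.{w} X] [Abelian X] [IsGrothendieckAbelian.{w} X]
  {Z : ObjectProperty X} [IsClosedSubcategory Z] {G : X ⥤ X} {μ : 𝟭 X ⟶ G}

lemma extProdMap_bijective_of_retract {ι : Type w} {N N' : ι → X} (i : ∀ a, N' a ⟶ N a)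
    (r : ∀ a, N a ⟶ N' a) (hr : ∀ a, i a ≫ r a = 𝟙 _) (M : X)
    (h : Function.Bijective (extProdMap M N)) : Function.Bijective (extProdMap M N') := by
  refine ⟨extProdMap_injective M N', fun e => ?_⟩
  obtain ⟨x, hx⟩ := h.2 fun a => (e a).comp (Abelian.Ext.mk₀ (i a)) (add_zero 1)
  refine ⟨x.comp (Abelian.Ext.mk₀ (Limits.Pi.map r)) (add_zero 1), funext fun a => ?_⟩
  have hx' := congrFun hx a
  rw [extProdMap_apply] at hx' ⊢
  rw [Abelian.Ext.comp_assoc_of_third_deg_zero, Abelian.Ext.mk₀_comp_mk₀, Limits.Pi.map_π,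
    ← Abelian.Ext.mk₀_comp_mk₀, ← Abelian.Ext.comp_assoc_of_third_deg_zero, hx',
    Abelian.Ext.comp_assoc_of_third_deg_zero, Abelian.Ext.mk₀_comp_mk₀, hr,
    Abelian.Ext.comp_mk₀_id]

omit [IsGrothendieckAbelian.{w} X] in
lemma injectivesIn_kernel {S : ShortComplex X} (hS : S.Exact) (hf : Mono S.f)
    (h : injectivesIn Z S.X₁) : injectivesIn Z (kernel S.g) := by
  refine injectivesIn_of_retract h (hS.lift (kernel.ι S.g) (kernel.condition _))
    (kernel.lift _ S.f S.zero) ?_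
  rw [← cancel_mono (kernel.ι _), Category.assoc, kernel.lift_ι, hS.lift_f, Category.id_comp]

/-- Maps from `N` to the injective object containing the coseparator separate points of `N`, and
land in its largest subobject in `Z`. -/
lemma exists_mono_pi_largestSub {N : X} (hN : Z N) :
    ∃ (κ : Type w) (i : N ⟶ ∏ᶜ fun _ : κ =>
      (largestSub Z).obj (Injective.under (coseparator X))), Mono i := by
  choose g hg using fun k : N ⟶ coseparator X =>
    exists_comp_largestSubι hN (k ≫ Injective.ι (coseparator X))
  refine ⟨N ⟶ coseparator X, Pi.lift g, Preadditive.mono_of_cancel_zero _ fun {T} a ha => ?_⟩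
  refine (isCoseparator_coseparator X).def _ _ fun k => ?_
  have h₀ : a ≫ g k = 0 := by simpa using congrArg (· ≫ Pi.π _ k) ha
  rw [← cancel_mono (Injective.ι (coseparator X)), Category.assoc, ← hg, reassoc_of% h₀]
  simp

/-- Each class `e i` dies on `P`, hence comes from a map `ker π ⟶ N i`. Together these give a map
`ker π ⟶ ∏ N`, along which the class of `π` is pushed out. -/
lemma extProdMap_bijective_of_hasProjectiveEffacements
    (hS : HasProjectiveEffacements (injectivesIn Z)) {ι : Type w} (N : ι → X)
    (hN : ∀ i, injectivesIn Z (N i)) (M : X) : Function.Bijective (extProdMap M N) := by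
  refine ⟨extProdMap_injective M N, fun e => ?_⟩
  obtain ⟨P, π, hπ⟩ := hS M
  have := hπ.epi
  have hπ' : (ShortComplex.mk (kernel.ι π) π (kernel.condition π)).ShortExact :=
    { exact := ShortComplex.exact_kernel π
      mono_f := inferInstanceAs (Mono (kernel.ι π))
      epi_g := inferInstanceAs (Epi π) }
  let S (i : ι) : ShortComplex X :=
    ShortComplex.mk (Injective.ι (N i)) (cokernel.π (Injective.ι (N i))) (cokernel.condition _)
  have hS (i : ι) : (S i).ShortExact :=
    { exact := ShortComplex.exact_cokernel _
      mono_f := inferInstanceAs (Mono (Injective.ι (N i)))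
      epi_g := inferInstanceAs (Epi (cokernel.π (Injective.ι (N i)))) }
  have h₀ (i : ι) : (Abelian.Ext.mk₀ π).comp (e i) (zero_add 1) = 0 := by
    have : Injective (S i).X₂ := inferInstanceAs (Injective (Injective.under (N i)))
    have := (hS i).epi_g
    obtain ⟨k, hk⟩ := exists_homToExt_eq (hS i) (e i)
    rw [← hk, mk₀_comp_homToExt, homToExt_eq_zero_iff]
    exact hπ.exists_comp_eq (S i).g (injectivesIn_kernel (hS i).exact (hS i).mono_f (hN i)) k
  choose φ hφ using fun i =>
    Abelian.Ext.contravariant_sequence_exact₃ hπ' (N i) (e i) (h₀ i) (add_zero 1)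
  refine ⟨hπ'.extClass.comp (Abelian.Ext.mk₀ (Pi.lift fun i => Abelian.Ext.homEquiv₀ (φ i)))
    (add_zero 1), funext fun i => ?_⟩
  rw [extProdMap_apply, Abelian.Ext.comp_assoc_of_third_deg_zero, Abelian.Ext.mk₀_comp_mk₀,
    Pi.lift_π, Abelian.Ext.mk₀_homEquiv₀_apply, hφ]

namespace IsQuotientUnit

variable (h : IsQuotientUnit Z μ)

include h

omit [IsGrothendieckAbelian.{w} X] in
/-- The short exact sequence `0 ⟶ o_Z E ⟶ E ⟶ G E ⟶ 0` of an injective object `E`. -/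
lemma shortExact (E : X) [Injective E] :
    (ShortComplex.mk (X₂ := E) ((largestSubι Z).app E) (μ.app E) (h.zero E)).ShortExact where
  exact := by
    refine ShortComplex.exact_of_f_is_kernel _ (KernelFork.IsLimit.ofι' _ _ fun b hb => ?_)
    exact ⟨(h.exists_lift b hb).choose, (h.exists_lift b hb).choose_spec⟩
  mono_f := inferInstanceAs (Mono ((largestSubι Z).app E))
  epi_g := h.epi E

lemma extProdMap_bijective_of_preservesProducts {ι : Type w}
    [PreservesLimitsOfShape (Discrete ι) G] (N : ι → X) (hN : ∀ i, injectivesIn Z (N i)) (M : X) :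
    Function.Bijective (extProdMap M N) := by
  let E (i : ι) : X := Injective.under (N i)
  choose j hj using fun i => exists_comp_largestSubι (injectivesIn_iff.1 (hN i)).1
    (Injective.ι (N i))
  have (i : ι) : Mono (j i) := mono_of_mono_fac (hj i)
  choose r hr using fun i => exists_retraction (hN i) (j i) (prop_largestSub Z _)
  refine extProdMap_bijective_of_retract j r hr M ?_
  refine (extProdMap_bijective_iff (fun i => h.shortExact (E i))
    (fun i => inferInstanceAs (Injective (Injective.under (N i))))).2 ?_ M
  -- The product `∏ E` is injective, and the product of the maps `μ.app (E i)` is `μ.app (∏ᶜ E)` up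
  -- to the comparison isomorphism.
  have := h.epi (∏ᶜ E)
  have h₀ : (Limits.Pi.map fun i => μ.app (E i)) = μ.app (∏ᶜ E) ≫ piComparison G E :=
    Pi.hom_ext _ _ fun i => by
      have := μ.naturality (Pi.π E i)
      simpa using this
  change Epi (Limits.Pi.map fun i => μ.app (E i))
  rw [h₀]
  exact epi_comp _ _

/-- The construction annihilates all of `Ext¹(M, o_Z E)` at once; this suffices because each object
of `S` is a retract of a power of `o_Z E`. -/
lemma exists_effacement (hS : ∀ (ι : Type w) (N : ι → X), (∀ i, injectivesIn Z (N i)) →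
    ∀ M : X, Function.Bijective (extProdMap M N)) (M : X) :
    ∃ (P : X) (π : P ⟶ M), IsProjectiveEffacement (injectivesIn Z) π ∧
      injectivesIn Z (kernel π) := by
  let E : X := Injective.under (coseparator X)
  have hE := h.shortExact E
  have hJ := injectivesIn_largestSub (Z := Z) E
  let f : (∏ᶜ fun _ : M ⟶ G.obj E => E) ⟶ ∏ᶜ fun _ : M ⟶ G.obj E => G.obj E :=
    Limits.Pi.map fun _ => μ.app E
  have hf : Epi f := (extProdMap_bijective_iff (fun _ : M ⟶ G.obj E => hE)
    (fun _ => (inferInstance : Injective E))).1 (hS _ _ fun _ => hJ)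
  let m : M ⟶ ∏ᶜ fun _ : M ⟶ G.obj E => G.obj E := Pi.lift id
  let π : pullback f m ⟶ M := pullback.snd f m
  have hπ (k : M ⟶ G.obj E) : ∃ t, t ≫ μ.app E = π ≫ k :=
    ⟨pullback.fst f m ≫ Pi.π _ k, by
      have h₁ : f ≫ Pi.π (fun _ => G.obj E) k = Pi.π (fun _ => E) k ≫ μ.app E := Limits.Pi.map_π _ _
      have h₂ : m ≫ Pi.π _ k = k := by simp [m]
      rw [Category.assoc]
      change _ ≫ Pi.π (fun _ => E) k ≫ μ.app E = _
      rw [← h₁, pullback.condition_assoc, h₂]⟩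
  refine ⟨_, π, ⟨inferInstance, fun {Q} q _ hq => ?_⟩, ?_⟩
  · have hq' : (ShortComplex.mk (kernel.ι q) q (kernel.condition q)).ShortExact :=
      { exact := ShortComplex.exact_kernel q
        mono_f := inferInstanceAs (Mono (kernel.ι q))
        epi_g := inferInstanceAs (Epi q) }
    refine (homToExt_eq_zero_iff hq' π).1 ?_
    obtain ⟨κ, i, hi⟩ := exists_mono_pi_largestSub (injectivesIn_iff.1 hq).1
    obtain ⟨r, hr⟩ := exists_retraction hq i (prop_pi _ fun _ => prop_largestSub Z E)
    -- Each coordinate is the pullback along `π` of a class in `Ext¹(M, o_Z E)`. That class comes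
    -- from some `m' : M ⟶ G E`, and `π ≫ m'` lifts to `E`.
    have h₀ : (homToExt hq' π).comp (Abelian.Ext.mk₀ i) (add_zero 1) = 0 := by
      refine extProdMap_injective _ _ (funext fun k => ?_)
      obtain ⟨m', hm'⟩ := exists_homToExt_eq hE
        ((homToExt hq' (𝟙 M)).comp (Abelian.Ext.mk₀ (i ≫ Pi.π _ k)) (add_zero 1))
      rw [map_zero, extProdMap_apply, Abelian.Ext.comp_assoc_of_third_deg_zero,
        Abelian.Ext.mk₀_comp_mk₀, ← Category.comp_id π, ← mk₀_comp_homToExt,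
        Abelian.Ext.comp_assoc_of_third_deg_zero, ← hm', mk₀_comp_homToExt]
      exact (homToExt_eq_zero_iff hE _).2 (hπ m')
    have h₁ := congrArg (·.comp (Abelian.Ext.mk₀ r) (add_zero 1)) h₀
    simpa [Abelian.Ext.comp_assoc_of_third_deg_zero, hr] using h₁
  · have sq := (IsPullback.of_hasPullback f m).flip
    have := isIso_kernel_map_of_isPullback sq
    refine (injectivesIn Z).prop_of_iso (asIso (kernel.map _ _ _ _ sq.w)).symm ?_
    exact injectivesIn_kernel (S := piComplex fun _ : M ⟶ G.obj E => ShortComplex.mk (X₂ := E)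
      ((largestSubι Z).app E) (μ.app E) (h.zero E)) (piComplex_exact fun _ => hE)
      (mono_piComplex_f fun _ => hE) (injectivesIn_pi _ fun _ => hJ)

end IsQuotientUnit

end Equivalences

end WellClosed

open WellClosed in
theorem mainTheorem1 {X : Type u} [Category.{w} X] [Abelian X] [IsGrothendieckAbelian.{w} X]
    [IsLocallyNoetherianCategory X] (Z : ObjectProperty X) [IsClosedSubcategory Z] :
    Mono (θ Z) ∧ HasCokernel (θ Z) ∧
    ∀ (G : X ⥤ₗ X) (μ : oId X ⟶ G) (hμ : θ Z ≫ μ = 0),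
      Nonempty (IsColimit (CokernelCofork.ofπ μ hμ)) →
      List.TFAE
        [ G.obj.IsRightAdjoint,
          ∀ ι : Type w, PreservesLimitsOfShape (Discrete ι) G.obj,
          ∀ (ι : Type w) (N : ι → X), (∀ i, injectivesIn Z (N i)) →
            IsZero ((R1Prod ι).obj (Discrete.functor N)),
          ∀ (ι : Type w) (N : ι → X), (∀ i, injectivesIn Z (N i)) →
            ∀ M : X, Function.Bijective (extProdMap M N),
          HasProjectiveEffacements (injectivesIn Z) ] ∧
      ∀ F : X ⥤ X, Nonempty (F ⊣ G.obj) →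
        (∀ M : X, ∃ (P : X) (π : P ⟶ M),
          IsProjectiveEffacement (injectivesIn Z) π ∧ injectivesIn Z (kernel π)) ∧
        ∀ (P : X → X) (π : ∀ M, P M ⟶ M),
          (∀ M, IsProjectiveEffacement (injectivesIn Z) (π M) ∧ injectivesIn Z (kernel (π M))) →
          (∀ {M N : X} (f : M ⟶ N), ∃ g : P M ⟶ P N, g ≫ π N = π M ≫ f) ∧
          ∃ e : ∀ M, F.obj M ≅ (K Z).obj (P M),
            ∀ {M N : X} (f : M ⟶ N) (g : P M ⟶ P N), g ≫ π N = π M ≫ f →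
              F.map f ≫ (e N).hom = (e M).hom ≫ (K Z).map g := by
  refine ⟨mono_θ Z, hasCokernel_θ Z, fun G μ hμ ⟨hG⟩ => ?_⟩
  have h : IsQuotientUnit Z μ.hom := IsQuotientUnit.of_isColimit hG
  have h₁₂ : G.obj.IsRightAdjoint →
      ∀ ι : Type w, PreservesLimitsOfShape (Discrete ι) G.obj :=
    fun _ ι =>
      (Adjunction.ofIsRightAdjoint G.obj).rightAdjoint_preservesLimits.preservesLimitsOfShape
  have h₂₄ (h₂ : ∀ ι : Type w, PreservesLimitsOfShape (Discrete ι) G.obj) (ι : Type w)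
      (N : ι → X) (hN : ∀ i, injectivesIn Z (N i)) (M : X) :
      Function.Bijective (extProdMap M N) :=
    have := h₂ ι
    h.extProdMap_bijective_of_preservesProducts N hN M
  refine ⟨?_, fun F ⟨adj⟩ => ?_⟩
  · tfae_have 1 → 2 := h₁₂
    tfae_have 2 → 4 := h₂₄
    tfae_have 3 ↔ 4 := forall₃_congr fun ι N _ => isZero_R1Prod_iff N
    tfae_have 4 → 5 := fun h₄ M => by
      obtain ⟨P, π, hπ, -⟩ := h.exists_effacement h₄ M
      exact ⟨P, π, hπ⟩
    tfae_have 5 → 4 := fun h₅ ι N hN M =>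
      extProdMap_bijective_of_hasProjectiveEffacements h₅ N hN M
    tfae_have 4 → 1 := fun h₄ => h.isRightAdjoint (h.exists_effacement h₄)
    tfae_finish
  -- Condition 4 yields effacements whose kernel is in `S`, which is more than condition 5 asserts.
  · exact ⟨h.exists_effacement (h₂₄ (h₁₂ adj.isRightAdjoint)),
      fun P π hπ => h.exists_iso_K adj P π hπ⟩
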